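/- **Theorem (average degree with secrecy threshold and unequal noise).** Let $\Pi_\ell,\Pi_e\subset\mathbb R^2$ be independent homogeneous Poisson point processes (legitimate nodes and eavesdroppers) with densities $\lambda_\ell,\lambda_e>0$. Let $P_\ell>0$ be the transmit power, $\sigma_\ell^2,\sigma_e^2>0$ the noise powers, $\varrho\ge 0$ the secrecy rate threshold, and $g(r)=r^{-2b}$ $(r>0)$, with $b>0$, the channel gain. For a transmitter $x$ and a receiver $y$ let $$R_s(x,y)=\Big[\log_2\Big(1+\frac{P_\ell\, g(|x-y|)}{\sigma_\ell^2}\Big)-\log_2\Big(1+\frac{P_\ell\, g(|x-e^*|)}{\sigma_e^2}\Big)\Big]^+,\qquad e^*=\operatorname*{argmax}_{e\in\Pi_e}P_\ell\, g(|x-e|),$$ be the maximum secrecy rate, and consider the directed graph with vertex set $\Pi_\ell\cup\{0\}$ that has an edge from $x$ to $y\ne x$ if and only if $R_s(x,y)>\varrho$. Let $N_{\mathrm{in}}$ and $N_{\mathrm{out}}$ be the in-degree and the out-degree of the typical node, that is, of the node at the origin in this graph. Then $N_{\mathrm{in}}$ and $N_{\mathrm{out}}$ are (almost everywhere equal to)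 random variables, and $$\mathbb E\{N_{\mathrm{in}}\}=\mathbb E\{N_{\mathrm{out}}\}=\pi^2\lambda_\ell\lambda_e\int_0^\infty \frac{x\,e^{-\pi\lambda_e x}}{\Big(\frac{\sigma_\ell^2}{\sigma_e^2}2^{\varrho}+\frac{\sigma_\ell^2}{P_\ell}(2^{\varrho}-1)x^b\Big)^{1/b}}\,dx\ \le\ \frac{\lambda_\ell}{\lambda_e}\,\frac{1}{\Big(\frac{\sigma_\ell^2}{\sigma_e^2}2^{\varrho}+\frac{\sigma_\ell^2}{P_\ell(\pi\lambda_e)^b}(2^{\varrho}-1)\Big)^{1/b}},$$ where the integral converges. -/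

import Mathlib

open MeasureTheory ProbabilityTheory
open scoped ENNReal

namespace SecrecyGraph

/-- The Euclidean plane, with its Euclidean distance and Lebesgue measure. -/
abbrev Plane : Type := EuclideanSpace ℝ (Fin 2)

/-- The family of counts `N(B) = #(S ∩ B)` of a set of points, over all Borel sets `B`. -/
noncomputable def counts (S : Set Plane) (B : {B : Set Plane // MeasurableSet B}) : ℕ∞ :=
  (S ∩ B).encard

/-- A random set of points `X` is a homogeneous Poisson point process with density `lam`:
the counts are random variables, the count of a Borel set of finite area `|B|` is a Poisson
variable with mean `lam * |B|`, and the counts of disjoint Borel sets are independent.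
(Local finiteness of `X`, almost surely, is a consequence.) -/
structure IsPoissonProcess {Ω : Type*} [MeasurableSpace Ω] (P : Measure Ω) (lam : ℝ)
    (X : Ω → Set Plane) : Prop where
  measurable_counts : Measurable fun ω => counts (X ω)
  law_count : ∀ B : Set Plane, MeasurableSet B → volume B ≠ ∞ →
    P.map (fun ω => (X ω ∩ B).encard) =
      (poissonMeasure (lam * volume.real B).toNNReal).map (fun k : ℕ => (k : ℕ∞))
  indep_counts : ∀ (n : ℕ) (B : Fin n → Set Plane), (∀ i, MeasurableSet (B i)) →
    Pairwise (fun i j => Disjoint (B i) (B j)) →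
    iIndepFun (fun i ω => (X ω ∩ B i).encard) P

/-- Two random sets of points are independent: their families of counts are. -/
def IndepProcesses {Ω : Type*} [MeasurableSpace Ω] (P : Measure Ω) (X Y : Ω → Set Plane) : Prop :=
  IndepFun (fun ω => counts (X ω)) (fun ω => counts (Y ω)) P

/-- Physical parameters of the network: transmit power `power` of the legitimate nodes, noise
powers `noiseL` of the legitimate nodes and `noiseE` of the eavesdroppers, and channel gain
`gain r` at distance `r > 0` (deterministic path loss). -/
structure Params where
  power : ℝ
  noiseL : ℝ
  noiseE : ℝ
  gain : ℝ → ℝ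

/-- Received power at `y` of a transmission from `x`. -/
noncomputable def Params.receivedPower (p : Params) (x y : Plane) : ℝ :=
  p.power * p.gain (dist x y)

/-- `e` is an eavesdropper with the strongest signal from `x`: an argmax, over the
eavesdroppers in `E`, of the received power. -/
def Params.IsStrongest (p : Params) (E : Set Plane) (x e : Plane) : Prop :=
  e ∈ E ∧ ∀ e' ∈ E, p.receivedPower x e' ≤ p.receivedPower x e

/-- Maximum secrecy rate of the link from `x` to `y`, against an eavesdropper at `e`. -/
noncomputable def Params.secrecyRate (p : Params) (x y e : Plane) : ℝ :=
  max (Real.logb 2 (1 + p.receivedPower x y / p.noiseL)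
    - Real.logb 2 (1 + p.receivedPower x e / p.noiseE)) 0

/-- The intrinsically secure graph with vertex set `L` (legitimate nodes), eavesdroppers `E`
and threshold `rho`: there is an edge from `x` to another vertex `y` if the maximum secrecy
rate of this link, against the strongest eavesdropper, exceeds `rho`. -/
def iSGraph (p : Params) (rho : ℝ) (L E : Set Plane) : Digraph L where
  Adj x y := x ≠ y ∧ ∃ e, p.IsStrongest E x e ∧ rho < p.secrecyRate x y e

/-- Number of edges that leave the vertex `v`. -/
noncomputable def outDegree {V : Type*} (G : Digraph V) (v : V) : ℕ∞ := {w | G.Adj v w}.encard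

/-- Number of edges that enter the vertex `v`. -/
noncomputable def inDegree {V : Type*} (G : Digraph V) (v : V) : ℕ∞ := {w | G.Adj w v}.encard

/-- Out-degree of the typical node: the node at the origin, in the graph whose legitimate nodes
are those of `L` together with the origin. -/
noncomputable def typicalOutDegree (p : Params) (rho : ℝ) (L E : Set Plane) : ℕ∞ :=
  outDegree (iSGraph p rho (insert 0 L) E) ⟨0, Set.mem_insert 0 L⟩

/-- In-degree of the typical node. -/
noncomputable def typicalInDegree (p : Params) (rho : ℝ) (L E : Set Plane) : ℕ∞ :=
  inDegree (iSGraph p rho (insert 0 L) E) ⟨0, Set.mem_insert 0 L⟩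

end SecrecyGraph

/-! Put `a = π λ_e`, `A = (σ_ℓ²/σ_e²) 2^ρ` and `C = (σ_ℓ²/P_ℓ)(2^ρ - 1)`. The strongest eavesdropper
is the nearest one, so solving the rate inequality for the link length shows that, almost surely,
`x` has an edge to `y` iff `|x - y|² < φ(d(x, E)²)`, where `φ(t) = t / (A + C t^b)^(1/b)` is
`secrecyReach`. The two degrees thus count the points `x` of `L` with `|x|² < φ(d(c x, E)²)`, where
`c x = 0` for the out-degree and `c x = x` for the in-degree.

Since `L` and `E` are independent, Campbell's formula
(`IsPoissonProcess.lintegral_lintegral_pointMeasure`) turns the mean count into `λ_ℓ ∫ P(|x|² <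
φ(d(c x, E)²)) dx`. By `IsPoissonProcess.map_infDist_sq`, `d(c, E)²` is exponential with rate `a`
for every point `c`; hence the two means agree, and Tonelli gives `λ_ℓ π E[φ(T)]` with `T`
exponential, which is the stated integral.

The bound is Jensen's inequality: `φ(t) = (A t^(-b) + C)^(-1/b)` is concave and `T` has mean `1/a`.
It is proved by integrating the tangent line at `1/a` (`secrecyReach_le_tangent`).

The processes are known only through their counts, so measurability rests on a kernel that sends a
configuration to its counting measure. The exceptional events (no eavesdropper, accumulation of
points, coincident points) are shown to be null. -/

namespace SecrecyGraph

/-! ### Configurations and their counting measures -/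

/-- Sets of points of the plane, with the σ-algebra generated by the counts of Borel sets. -/
structure Configuration where
  points : Set Plane

noncomputable instance : MeasurableSpace Configuration :=
  MeasurableSpace.comap (fun S => counts S.points) inferInstance

theorem measurable_configuration {Ω : Type*} [MeasurableSpace Ω] {X : Ω → Set Plane}
    (hX : Measurable fun ω => counts (X ω)) :
    Measurable fun ω => Configuration.mk (X ω) :=
  measurable_comap_iff.2 hX

theorem measurable_encard_inter {B : Set Plane} (hB : MeasurableSet B) :
    Measurable fun S : Configuration => (S.points ∩ B).encard :=
  (measurable_pi_apply (⟨B, hB⟩ : {B : Set Plane // MeasurableSet B})).comp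
    (comap_measurable fun S : Configuration => counts S.points)

/-- The set of points is finite in each ball around the origin. -/
def IsLocallyFinite (S : Set Plane) : Prop := ∀ n : ℕ, (S ∩ Metric.closedBall 0 n).Finite

/-- The counting measure of a set of points. -/
noncomputable def pointMeasure (S : Set Plane) : Measure Plane :=
  Measure.sum fun x : S => Measure.dirac (x : Plane)

theorem pointMeasure_apply (S : Set Plane) {B : Set Plane} (hB : MeasurableSet B) :
    pointMeasure S B = ((S ∩ B).encard : ℝ≥0∞) := by
  rw [pointMeasure, Measure.sum_apply _ hB, ← ENNReal.tsum_set_one,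
    tsum_subtype (S ∩ B) (fun _ => (1 : ℝ≥0∞))]
  simp_rw [Measure.dirac_apply' _ hB]
  rw [tsum_subtype S (B.indicator 1), Set.indicator_indicator]
  rfl

/-- The counting measure of a set of points, as a kernel. -/
noncomputable def pointKernel : Kernel Configuration Plane where
  toFun S := pointMeasure S.points
  measurable' := by
    refine Measure.measurable_of_measurable_coe _ fun B hB => ?_
    simp_rw [pointMeasure_apply _ hB]
    exact Measurable.of_discrete.comp (measurable_encard_inter hB)

theorem pointKernel_apply (S : Configuration) : pointKernel S = pointMeasure S.points := rfl

/-- Disjoint annuli that cover the plane. -/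
def annulus : ℕ → Set Plane := disjointed fun n : ℕ => Metric.closedBall 0 n

theorem measurableSet_annulus (n : ℕ) : MeasurableSet (annulus n) :=
  MeasurableSet.disjointed (fun _ => Metric.isClosed_closedBall.measurableSet) n

theorem iUnion_annulus : ⋃ n, annulus n = Set.univ := by
  rw [annulus, iUnion_disjointed, Metric.iUnion_closedBall_nat]

/-- The part of the counting measure on an annulus, if it has mass `k` there. -/
noncomputable def annulusKernel (i : ℕ × ℕ) : Kernel Configuration Plane := by
  classical
  exact Kernel.piecewise
    (measurable_encard_inter (measurableSet_annulus i.1) (MeasurableSet.singleton (i.2 : ℕ∞)))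
    (pointKernel.restrict (measurableSet_annulus i.1)) 0

theorem annulusKernel_apply (i : ℕ × ℕ) (S : Configuration) {B : Set Plane}
    (hB : MeasurableSet B) [Decidable ((S.points ∩ annulus i.1).encard = i.2)] :
    annulusKernel i S B =
      if (S.points ∩ annulus i.1).encard = i.2
        then pointMeasure S.points (B ∩ annulus i.1) else 0 := by
  classical
  rw [annulusKernel, Kernel.piecewise_apply']
  simp only [Set.mem_preimage, Set.mem_singleton_iff, Kernel.restrict_apply' _ _ _ hB]
  split_ifs <;> simp [pointKernel_apply]

/-- A finite kernel needs a bound uniform over all configurations. Restriction to an annulus does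
not give one; fixing the mass `k` there does. -/
instance (i : ℕ × ℕ) : IsFiniteKernel (annulusKernel i) := by
  classical
  refine ⟨i.2, ENNReal.natCast_lt_top _, fun S => ?_⟩
  rw [annulusKernel_apply _ _ MeasurableSet.univ]
  split_ifs with h
  · rw [Set.univ_inter, pointMeasure_apply _ (measurableSet_annulus _), h]
    simp
  · simp

/-- An s-finite version of `pointKernel`. -/
noncomputable def locallyFiniteKernel : Kernel Configuration Plane := Kernel.sum annulusKernel

instance : IsSFiniteKernel locallyFiniteKernel := by
  unfold locallyFiniteKernel; infer_instance

/-- On each annulus exactly one value of `k` is the actual count, so the pieces reassemble the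
counting measure. An annulus with infinitely many points would contribute zero, hence the
restriction on `S`. -/
theorem locallyFiniteKernel_apply {S : Configuration} (hS : IsLocallyFinite S.points) :
    locallyFiniteKernel S = pointMeasure S.points := by
  classical
  ext B hB
  rw [locallyFiniteKernel, Kernel.sum_apply' _ _ hB,
    ENNReal.tsum_prod (f := fun n k => annulusKernel (n, k) S B)]
  have key : ∀ n, ∑' k, annulusKernel (n, k) S B = pointMeasure S.points (B ∩ annulus n) := fun n => by
    have hfin : (S.points ∩ annulus n).Finite :=
      (hS n).subset (Set.inter_subset_inter_right _ (disjointed_subset _ n))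
    rw [tsum_eq_single hfin.toFinset.card]
    · rw [annulusKernel_apply _ _ hB, if_pos hfin.encard_eq_coe_toFinset_card]
    · intro k hk
      rw [annulusKernel_apply _ _ hB, if_neg]
      rw [hfin.encard_eq_coe_toFinset_card]
      exact_mod_cast hk.symm
  simp_rw [key]
  rw [← measure_iUnion, ← Set.inter_iUnion, iUnion_annulus, Set.inter_univ]
  · intro i j hij
    exact ((disjoint_disjointed _ hij).mono Set.inter_subset_right Set.inter_subset_right)
  · exact fun i => hB.inter (measurableSet_annulus i)

/-! ### Distance to a configuration -/

theorem IsLocallyFinite.finite_inter_closedBall {S : Set Plane} (hS : IsLocallyFinite S)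
    (x : Plane) (r : ℝ) : (S ∩ Metric.closedBall x r).Finite := by
  obtain ⟨n, hn⟩ := exists_nat_ge (r + dist x 0)
  exact (hS n).subset (Set.inter_subset_inter_right _ (Metric.closedBall_subset_closedBall' hn))

theorem IsLocallyFinite.exists_infDist_eq {S : Set Plane} (hS : IsLocallyFinite S)
    (hne : S.Nonempty) (x : Plane) : ∃ e ∈ S, Metric.infDist x S = dist x e := by
  obtain ⟨s, hs⟩ := hne
  obtain ⟨e, he, hmin⟩ := Set.exists_min_image _ (dist x)
    (hS.finite_inter_closedBall x (dist s x)) ⟨s, hs, Metric.mem_closedBall.2 le_rfl⟩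
  refine ⟨e, he.1, le_antisymm (Metric.infDist_le_dist_of_mem he.1) ?_⟩
  refine (Metric.le_infDist ⟨s, hs⟩).2 fun y hy => ?_
  rcases le_total (dist y x) (dist s x) with h | h
  · exact hmin y ⟨hy, h⟩
  · refine (hmin s ⟨hs, Metric.mem_closedBall.2 le_rfl⟩).trans ?_
    rwa [dist_comm x s, dist_comm x y]

/-- The distance is continuous in the point. For a fixed point, it is less than `r` iff the count of
the open ball of radius `r` is nonzero. Together these give joint measurability. -/
theorem measurable_infDist_configuration :
    Measurable fun z : Plane × Configuration => Metric.infDist z.1 z.2.points := by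
  have h : Measurable (Function.uncurry fun (x : Plane) (S : Configuration) =>
      Metric.infEDist x S.points) := by
    refine measurable_uncurry_of_continuous_of_measurable
      (fun S => Metric.continuous_infEDist) fun x => measurable_of_Iio fun r => ?_
    have : (fun S : Configuration => Metric.infEDist x S.points) ⁻¹' Set.Iio r =
        (fun S : Configuration => (S.points ∩ Metric.eball x r).encard) ⁻¹' {0}ᶜ := by
      ext S
      simp only [Set.mem_preimage, Set.mem_Iio, Set.mem_compl_iff, Set.mem_singleton_iff,
        Set.encard_eq_zero, ← ne_eq, ← Set.nonempty_iff_ne_empty]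
      rw [Metric.infEDist_lt_iff]
      simp only [Set.Nonempty, Set.mem_inter_iff, Metric.mem_eball, edist_comm x]
    rw [this]
    exact measurable_encard_inter Metric.isOpen_eball.measurableSet
      (MeasurableSet.singleton 0).compl
  exact h.ennreal_toReal

/-! ### Poisson processes: mean counts, void probabilities and Campbell's formula -/

section Poisson

variable {Ω : Type*} [MeasurableSpace Ω] {P : Measure Ω} {lam : ℝ} {X : Ω → Set Plane}

theorem IsPoissonProcess.measurable (hX : IsPoissonProcess P lam X) :
    Measurable fun ω => Configuration.mk (X ω) :=
  measurable_configuration hX.measurable_counts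

theorem IsPoissonProcess.measurable_encard (hX : IsPoissonProcess P lam X) {B : Set Plane}
    (hB : MeasurableSet B) : Measurable fun ω => (X ω ∩ B).encard :=
  (measurable_encard_inter hB).comp hX.measurable

theorem lintegral_poissonMeasure_natCast (r : NNReal) :
    ∫⁻ n : ℕ, (n : ℝ≥0∞) ∂poissonMeasure r = r := by
  rw [poissonMeasure, lintegral_sum_measure]
  simp only [lintegral_smul_measure, lintegral_dirac, smul_eq_mul]
  have hs : HasSum (fun n : ℕ => Real.exp (-r) * (r : ℝ) ^ n / n.factorial * n) r := by
    -- The term `n = 0` vanishes, and the factor `n + 1` cancels in the factorial, leaving `r` times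
    -- the Poisson weight of `n`.
    rw [← hasSum_nat_add_iff' 1]
    have h := (hasSum_one_poissonMeasure r).mul_left (r : ℝ)
    simp only [Finset.range_one, Finset.sum_singleton, Nat.cast_zero, mul_zero, sub_zero]
    rw [mul_one] at h
    refine h.congr_fun fun n => ?_
    rw [Nat.factorial_succ]
    push_cast
    field_simp
    ring
  have h2 : ∀ n : ℕ, ENNReal.ofReal (Real.exp (-r) * (r : ℝ) ^ n / n.factorial) * (n : ℝ≥0∞) =
      ENNReal.ofReal (Real.exp (-r) * (r : ℝ) ^ n / n.factorial * n) := fun n => by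
    rw [ENNReal.ofReal_mul (by positivity), ENNReal.ofReal_natCast]
  simp_rw [h2]
  rw [← ENNReal.ofReal_tsum_of_nonneg (fun n => by positivity) hs.summable, hs.tsum_eq,
    ENNReal.ofReal_coe_nnreal]

theorem IsPoissonProcess.lintegral_encard (hX : IsPoissonProcess P lam X) {B : Set Plane}
    (hB : MeasurableSet B) (hv : volume B ≠ ∞) (hlam : 0 ≤ lam) :
    ∫⁻ ω, ((X ω ∩ B).encard : ℝ≥0∞) ∂P = ENNReal.ofReal lam * volume B := by
  have h := lintegral_map (μ := P) (f := fun k : ℕ∞ => (k : ℝ≥0∞)) Measurable.of_discrete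
    (hX.measurable_encard hB)
  rw [← h, hX.law_count B hB hv, lintegral_map Measurable.of_discrete Measurable.of_discrete]
  simp only [ENat.toENNReal_coe]
  rw [lintegral_poissonMeasure_natCast, ← ENNReal.ofReal, ENNReal.ofReal_mul hlam,
    ofReal_measureReal hv]

theorem IsPoissonProcess.measure_inter_eq_empty (hX : IsPoissonProcess P lam X) {B : Set Plane}
    (hB : MeasurableSet B) (hv : volume B ≠ ∞) (hlam : 0 ≤ lam) :
    P {ω | X ω ∩ B = ∅} = ENNReal.ofReal (Real.exp (-(lam * volume.real B))) := by
  have h := Measure.map_apply (μ := P) (hX.measurable_encard hB) (MeasurableSet.singleton 0)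
  have h2 : (fun k : ℕ => (k : ℕ∞)) ⁻¹' {0} = {0} := by ext; simp
  rw [hX.law_count B hB hv, Measure.map_apply Measurable.of_discrete (MeasurableSet.singleton 0),
    h2, poissonMeasure_singleton] at h
  have h3 : (fun ω => (X ω ∩ B).encard) ⁻¹' {0} = {ω | X ω ∩ B = ∅} := by ext; simp
  rw [← h3, ← h]
  have : 0 ≤ lam * volume.real B := by positivity
  simp [this]

/-- The count of a ball has a law carried by `ℕ`, hence without mass at `⊤`. -/
theorem IsPoissonProcess.ae_isLocallyFinite (hX : IsPoissonProcess P lam X) :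
    ∀ᵐ ω ∂P, IsLocallyFinite (X ω) := by
  refine ae_all_iff.2 fun n => ?_
  have hB : MeasurableSet (Metric.closedBall (0 : Plane) n) :=
    Metric.isClosed_closedBall.measurableSet
  have h := Measure.map_apply (μ := P) (hX.measurable_encard hB) (MeasurableSet.singleton ⊤)
  have h2 : (fun k : ℕ => (k : ℕ∞)) ⁻¹' {⊤} = ∅ := by ext; simp
  rw [hX.law_count _ hB measure_closedBall_lt_top.ne,
    Measure.map_apply Measurable.of_discrete (MeasurableSet.singleton ⊤), h2, measure_empty] at h
  rw [ae_iff, h]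
  congr 1
  ext ω
  simp

theorem IsPoissonProcess.ae_locallyFiniteKernel (hX : IsPoissonProcess P lam X) :
    ∀ᵐ ω ∂P, locallyFiniteKernel ⟨X ω⟩ = pointMeasure (X ω) := by
  filter_upwards [hX.ae_isLocallyFinite] with ω hω
  exact locallyFiniteKernel_apply (S := ⟨X ω⟩) hω

/-- This is the intensity measure of the process. Mean counts identify it inside each ball, where
areas are finite, and the balls exhaust the plane. -/
theorem IsPoissonProcess.bind_locallyFiniteKernel (hX : IsPoissonProcess P lam X)
    (hlam : 0 ≤ lam) :
    (P.map fun ω => Configuration.mk (X ω)).bind locallyFiniteKernel =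
      ENNReal.ofReal lam • (volume : Measure Plane) := by
  refine Measure.ext_of_iUnion_eq_univ (Metric.iUnion_closedBall_nat (0 : Plane)) fun n => ?_
  have hBn : MeasurableSet (Metric.closedBall (0 : Plane) n) :=
    Metric.isClosed_closedBall.measurableSet
  ext B hB
  have hm := hB.inter hBn
  rw [Measure.restrict_apply hB, Measure.restrict_apply hB,
    Measure.bind_apply hm locallyFiniteKernel.measurable.aemeasurable,
    lintegral_map (locallyFiniteKernel.measurable_coe hm) hX.measurable]
  have h : ∀ᵐ ω ∂P, locallyFiniteKernel ⟨X ω⟩ (B ∩ Metric.closedBall 0 n) =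
      ((X ω ∩ (B ∩ Metric.closedBall 0 n)).encard : ℝ≥0∞) := by
    filter_upwards [hX.ae_locallyFiniteKernel] with ω hω
    rw [hω, pointMeasure_apply _ hm]
  rw [lintegral_congr_ae h, hX.lintegral_encard hm
    (measure_ne_top_of_subset Set.inter_subset_right measure_closedBall_lt_top.ne) hlam]
  rfl

/-- Measurability of an integral in its parameter is what requires an s-finite kernel in place of
`pointKernel`. -/
theorem measurable_lintegral_locallyFiniteKernel {h : Plane × Configuration → ℝ≥0∞}
    (hh : Measurable h) :
    Measurable fun z : Configuration × Configuration =>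
      ∫⁻ x, h (x, z.2) ∂locallyFiniteKernel z.1 := by
  have := Measurable.lintegral_kernel_prod_right'
    (κ := locallyFiniteKernel.comap Prod.fst (measurable_fst (β := Configuration)))
    (f := fun w : (Configuration × Configuration) × Plane => h (w.2, w.1.2)) (by fun_prop)
  simpa only [Kernel.comap_apply] using this

theorem IsPoissonProcess.aemeasurable_lintegral_pointMeasure
    (hX : IsPoissonProcess P lam X) {Y : Ω → Configuration} (hY : Measurable Y)
    {h : Plane × Configuration → ℝ≥0∞} (hh : Measurable h) :
    AEMeasurable (fun ω => ∫⁻ x, h (x, Y ω) ∂pointMeasure (X ω)) P := by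
  have hXY : Measurable fun ω => (Configuration.mk (X ω), Y ω) := hX.measurable.prodMk hY
  refine ⟨_, (measurable_lintegral_locallyFiniteKernel hh).comp hXY, ?_⟩
  filter_upwards [hX.ae_locallyFiniteKernel] with ω hω
  simp only [Function.comp_apply, hω]

/-- Campbell's formula for a mark that is independent of the process. -/
theorem IsPoissonProcess.lintegral_lintegral_pointMeasure [IsProbabilityMeasure P]
    (hX : IsPoissonProcess P lam X) (hlam : 0 ≤ lam)
    {Y : Ω → Configuration} (hY : Measurable Y)
    (hXY : IndepFun (fun ω => Configuration.mk (X ω)) Y P) {h : Plane × Configuration → ℝ≥0∞}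
    (hh : Measurable h) :
    ∫⁻ ω, ∫⁻ x, h (x, Y ω) ∂pointMeasure (X ω) ∂P =
      ENNReal.ofReal lam * ∫⁻ x, ∫⁻ ω, h (x, Y ω) ∂P := by
  have h1 : ∀ᵐ ω ∂P, ∫⁻ x, h (x, Y ω) ∂pointMeasure (X ω) =
      ∫⁻ x, h (x, Y ω) ∂locallyFiniteKernel ⟨X ω⟩ := by
    filter_upwards [hX.ae_locallyFiniteKernel] with ω hω
    rw [hω]
  have hΦ := measurable_lintegral_locallyFiniteKernel hh
  -- By independence the joint law is a product, so the points can be averaged out with the mark `T`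
  -- held fixed; `h2` evaluates that inner average by the intensity measure.
  rw [lintegral_congr_ae h1, ← lintegral_map (f := fun z : Configuration × Configuration =>
      ∫⁻ x, h (x, z.2) ∂locallyFiniteKernel z.1) hΦ (hX.measurable.prodMk hY),
    (indepFun_iff_map_prod_eq_prod_map_map hX.measurable.aemeasurable hY.aemeasurable).1 hXY,
    lintegral_prod_symm' _ hΦ]
  have h2 : ∀ T : Configuration, ∫⁻ S, ∫⁻ x, h (x, T) ∂locallyFiniteKernel S
      ∂(P.map fun ω => Configuration.mk (X ω)) = ENNReal.ofReal lam * ∫⁻ x, h (x, T) := by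
    intro T
    have hT : Measurable fun x => h (x, T) := by fun_prop
    rw [← Measure.lintegral_bind locallyFiniteKernel.measurable.aemeasurable hT.aemeasurable,
      hX.bind_locallyFiniteKernel hlam, lintegral_smul_measure, smul_eq_mul]
  simp only [h2]
  rw [lintegral_const_mul _ (by fun_prop), lintegral_lintegral_swap (by fun_prop)]
  congr 1
  refine lintegral_congr fun x => ?_
  rw [lintegral_map (by fun_prop) hY]

/-! ### Law of the nearest-point distance and almost sure disjointness -/

theorem IsPoissonProcess.measure_inter_closedBall_eq_empty (hX : IsPoissonProcess P lam X)
    (hlam : 0 ≤ lam) (x : Plane) {r : ℝ} (hr : 0 ≤ r) :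
    P {ω | X ω ∩ Metric.closedBall x r = ∅} =
      ENNReal.ofReal (Real.exp (-(Real.pi * lam * r ^ 2))) := by
  rw [hX.measure_inter_eq_empty Metric.isClosed_closedBall.measurableSet
    measure_closedBall_lt_top.ne hlam, measureReal_def, EuclideanSpace.volume_closedBall_fin_two]
  congr 3
  rw [ENNReal.toReal_mul, ENNReal.toReal_pow, ENNReal.toReal_ofReal hr,
    ENNReal.toReal_ofReal Real.pi_pos.le]
  ring

theorem IsPoissonProcess.ae_nonempty (hX : IsPoissonProcess P lam X) (hlam : 0 < lam) :
    ∀ᵐ ω ∂P, (X ω).Nonempty := by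
  have hlim : Filter.Tendsto
      (fun n : ℕ => ENNReal.ofReal (Real.exp (-(Real.pi * lam * (n : ℝ) ^ 2))))
      Filter.atTop (nhds 0) := by
    rw [← ENNReal.ofReal_zero]
    refine (ENNReal.continuous_ofReal.tendsto 0).comp (Real.tendsto_exp_neg_atTop_nhds_zero.comp ?_)
    exact ((Filter.tendsto_pow_atTop two_ne_zero).comp
      tendsto_natCast_atTop_atTop).const_mul_atTop (mul_pos Real.pi_pos hlam)
  rw [ae_iff, ← nonpos_iff_eq_zero]
  refine ge_of_tendsto' hlim fun n => ?_
  rw [← hX.measure_inter_closedBall_eq_empty hlam.le 0 n.cast_nonneg]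
  refine measure_mono fun ω hω => ?_
  rw [Set.mem_ofPred_eq, Set.not_nonempty_iff_eq_empty] at hω
  simp [hω]

theorem IsPoissonProcess.measurable_infDist (hX : IsPoissonProcess P lam X) (x : Plane) :
    Measurable fun ω => Metric.infDist x (X ω) := by
  have h : Measurable fun S : Configuration => Metric.infDist x S.points :=
    measurable_infDist_configuration.comp
      (f := fun S : Configuration => (x, S)) measurable_prodMk_left
  exact h.comp hX.measurable

/-- The squared distance to a Poisson process is exponentially distributed. -/
theorem IsPoissonProcess.map_infDist_sq [IsProbabilityMeasure P] (hX : IsPoissonProcess P lam X)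
    (hlam : 0 < lam) (x : Plane) :
    P.map (fun ω => Metric.infDist x (X ω) ^ 2) = expMeasure (Real.pi * lam) := by
  have hr : 0 < Real.pi * lam := mul_pos Real.pi_pos hlam
  have hm := (hX.measurable_infDist x).pow_const 2
  have := isProbabilityMeasure_expMeasure hr
  have := Measure.isProbabilityMeasure_map (μ := P) hm.aemeasurable
  refine Measure.eq_of_cdf _ _ (StieltjesFunction.ext fun t => ?_)
  rw [cdf_expMeasure_eq hr, cdf_eq_real, map_measureReal_apply hm measurableSet_Iic]
  split_ifs with ht
  · have hB : MeasurableSet {ω | X ω ∩ Metric.closedBall x √t = ∅} := by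
      have := hX.measurable_encard (Metric.isClosed_closedBall (x := x) (ε := √t)).measurableSet
        (MeasurableSet.singleton 0)
      convert this using 1
      ext; simp
    -- The equality is only almost sure: `infDist` to the empty set is `0` by convention, and a
    -- nearest point in the closed ball exists by local finiteness.
    have h : (fun ω => Metric.infDist x (X ω) ^ 2) ⁻¹' Set.Iic t =ᵐ[P]
        ({ω | X ω ∩ Metric.closedBall x √t = ∅}ᶜ : Set Ω) := by
      filter_upwards [hX.ae_isLocallyFinite, hX.ae_nonempty hlam] with ω hf hne
      refine propext (?_ : Metric.infDist x (X ω) ^ 2 ≤ t ↔ ¬ (X ω ∩ Metric.closedBall x √t = ∅))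
      rw [← Real.le_sqrt Metric.infDist_nonneg ht, ← ne_eq, ← Set.nonempty_iff_ne_empty]
      constructor
      · obtain ⟨e, he, hd⟩ := hf.exists_infDist_eq hne x
        intro h
        exact ⟨e, he, by rwa [Metric.mem_closedBall, dist_comm, ← hd]⟩
      · rintro ⟨e, he, hd⟩
        refine (Metric.infDist_le_dist_of_mem he).trans ?_
        rwa [Metric.mem_closedBall, dist_comm] at hd
    rw [measureReal_congr h, probReal_compl_eq_one_sub hB, measureReal_def,
      hX.measure_inter_closedBall_eq_empty hlam.le x (Real.sqrt_nonneg t),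
      ENNReal.toReal_ofReal (Real.exp_pos _).le, Real.sq_sqrt ht]
  · have : (fun ω => Metric.infDist x (X ω) ^ 2) ⁻¹' Set.Iic t = ∅ := by
      ext ω
      simp only [Set.mem_preimage, Set.mem_Iic, Set.mem_empty_iff_false, iff_false, not_le]
      exact (not_le.1 ht).trans_le (sq_nonneg _)
    simp [this]

theorem IsPoissonProcess.ae_infDist_ne_zero [IsProbabilityMeasure P]
    (hX : IsPoissonProcess P lam X) (hlam : 0 < lam) (x : Plane) :
    ∀ᵐ ω ∂P, Metric.infDist x (X ω) ≠ 0 := by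
  have hm := (hX.measurable_infDist x).pow_const 2
  have h : P.map (fun ω => Metric.infDist x (X ω) ^ 2) {0} = 0 := by
    rw [hX.map_infDist_sq hlam]
    exact withDensity_absolutelyContinuous _ _ (measure_singleton 0)
  rw [Measure.map_apply hm (MeasurableSet.singleton 0)] at h
  rw [ae_iff]
  convert h using 2
  ext; simp

theorem IsPoissonProcess.ae_notMem [IsProbabilityMeasure P]
    (hX : IsPoissonProcess P lam X) (hlam : 0 < lam) (x : Plane) : ∀ᵐ ω ∂P, x ∉ X ω := by
  filter_upwards [hX.ae_infDist_ne_zero hlam x] with ω hω hx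
  exact hω (Metric.infDist_zero_of_mem hx)

theorem IndepProcesses.indepFun {X Y : Ω → Set Plane} (h : IndepProcesses P X Y) :
    IndepFun (fun ω => Configuration.mk (X ω)) (fun ω => Configuration.mk (Y ω)) P := by
  unfold IndepProcesses at h
  rw [IndepFun_iff_Indep] at h ⊢
  simp only [instMeasurableSpaceConfiguration, MeasurableSpace.comap_comp]
  exact h

/-- By Campbell's formula the mean number of points of `X` at distance zero from `Y` is an integral
of probabilities that all vanish. Disjointness is needed for the in-degree, where every legitimate
node is a transmitter. -/
theorem IsPoissonProcess.ae_disjoint [IsProbabilityMeasure P] {lam' : ℝ} {Y : Ω → Set Plane}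
    (hX : IsPoissonProcess P lam X) (hlam : 0 < lam) (hY : IsPoissonProcess P lam' Y)
    (hlam' : 0 < lam') (hXY : IndepProcesses P X Y) : ∀ᵐ ω ∂P, Disjoint (X ω) (Y ω) := by
  have hA : MeasurableSet {z : Plane × Configuration | Metric.infDist z.1 z.2.points = 0} :=
    measurable_infDist_configuration (MeasurableSet.singleton 0)
  have hAx : ∀ S : Set Plane, MeasurableSet {x : Plane | Metric.infDist x S = 0} := fun S =>
    (Metric.continuous_infDist_pt S).measurable (MeasurableSet.singleton 0)
  have hh := measurable_one.indicator (f := (1 : Plane × Configuration → ℝ≥0∞)) hA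
  have h := hX.lintegral_lintegral_pointMeasure hlam.le hY.measurable hXY.indepFun hh
  have h0 : ∀ x, ∫⁻ ω, {z : Plane × Configuration | Metric.infDist z.1 z.2.points = 0}.indicator
      (1 : Plane × Configuration → ℝ≥0∞) (x, ⟨Y ω⟩) ∂P = 0 := fun x => by
    refine (lintegral_congr_ae (g := fun _ => (0 : ℝ≥0∞)) ?_).trans lintegral_zero
    filter_upwards [hY.ae_infDist_ne_zero hlam' x] with ω hω
    refine Set.indicator_of_notMem ?_ _
    exact hω
  simp only [h0, lintegral_zero, mul_zero] at h
  rw [lintegral_eq_zero_iff' (hX.aemeasurable_lintegral_pointMeasure hY.measurable hh)] at h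
  filter_upwards [h] with ω hω
  have h1 : pointMeasure (X ω) {x | Metric.infDist x (Y ω) = 0} = 0 := by
    rw [← lintegral_indicator_one (hAx _)]
    exact hω
  rw [pointMeasure_apply _ (hAx _)] at h1
  simp only [ENat.toENNReal_eq_zero, Set.encard_eq_zero] at h1
  refine Set.disjoint_left.2 fun x hx hy => ?_
  exact Set.notMem_empty x (h1 ▸ ⟨hx, Metric.infDist_zero_of_mem hy⟩)

end Poisson

/-! ### The secrecy reach: threshold, integrability and Jensen bound -/

/-- The largest squared length of an edge with secrecy, as a function of the squared distance `t`
from the transmitter to the eavesdroppers. -/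
noncomputable def secrecyReach (A C b t : ℝ) : ℝ := t / (A + C * t ^ b) ^ (1 / b)

variable {A C b : ℝ}

theorem secrecyReach_nonneg (hA : 0 < A) (hC : 0 ≤ C) {t : ℝ} (ht : 0 ≤ t) :
    0 ≤ secrecyReach A C b t := by
  unfold secrecyReach; positivity

theorem measurable_secrecyReach : Measurable (secrecyReach A C b) := by
  unfold secrecyReach; fun_prop

/-- Raising to the power `b` and inverting makes the condition affine in `1 / s ^ b` and `1 / t ^
b`, which are the channel gains when `s`, `t` are squared distances. -/
theorem lt_secrecyReach_iff (hA : 0 < A) (hC : 0 ≤ C) (hb : 0 < b) {s t : ℝ} (hs : 0 < s)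
    (ht : 0 < t) : s < secrecyReach A C b t ↔ C + A / t ^ b < 1 / s ^ b := by
  have hD : 0 < A + C * t ^ b := by positivity
  have hsb : 0 < s ^ b := by positivity
  have htb : 0 < t ^ b := by positivity
  rw [secrecyReach, ← Real.rpow_lt_rpow_iff hs.le (by positivity) hb,
    Real.div_rpow ht.le (by positivity), ← Real.rpow_mul hD.le, one_div, inv_mul_cancel₀ hb.ne',
    Real.rpow_one, lt_div_iff₀ hD, lt_div_iff₀ hsb]
  rw [← mul_lt_mul_iff_left₀ htb (b := (C + A / t ^ b) * s ^ b), one_mul]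
  field_simp
  rw [add_comm A]

/-- Since `rho ≥ 0`, the positive part plays no role. Exponentiating gives `2 ^ rho * (1 + Pl g(t) /
sE) < 1 + Pl g(s) / sL`, and multiplication by `sL / Pl` isolates `g(s)`. -/
theorem lt_logb_sub_logb_iff {Pl sL sE rho s t : ℝ} (hPl : 0 < Pl) (hsL : 0 < sL) (hsE : 0 < sE)
    (hrho : 0 ≤ rho) (hb : 0 < b) (hs : 0 < s) (ht : 0 < t) :
    rho < max (Real.logb 2 (1 + Pl * (1 / s ^ (2 * b)) / sL)
        - Real.logb 2 (1 + Pl * (1 / t ^ (2 * b)) / sE)) 0 ↔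
      s ^ 2 < secrecyReach (sL / sE * 2 ^ rho) (sL / Pl * (2 ^ rho - 1)) b (t ^ 2) := by
  have h2 : (1 : ℝ) ≤ 2 ^ rho := Real.one_le_rpow one_le_two hrho
  rw [lt_secrecyReach_iff (by positivity) (mul_nonneg (by positivity) (by linarith)) hb
    (by positivity) (by positivity), lt_max_iff, or_iff_left (not_lt.2 hrho), lt_sub_iff_add_lt,
    ← Real.rpow_natCast, ← Real.rpow_natCast, ← Real.rpow_mul hs.le, ← Real.rpow_mul ht.le,
    Nat.cast_ofNat]
  have hsb : 0 < s ^ (2 * b) := by positivity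
  have htb : 0 < t ^ (2 * b) := by positivity
  generalize s ^ (2 * b) = S at *
  generalize t ^ (2 * b) = T at *
  have h3 : rho = Real.logb 2 (2 ^ rho) := (Real.logb_rpow (by norm_num) (by norm_num)).symm
  rw [h3, ← Real.logb_mul (by positivity) (by positivity), ← h3,
    Real.logb_lt_logb_iff one_lt_two (by positivity) (by positivity)]
  rw [← mul_lt_mul_iff_right₀ (show 0 < sL / Pl by positivity), ← sub_pos,
    ← sub_pos (b := sL / Pl * (2 ^ rho - 1) + _)]
  congr! 1
  field_simp
  ring

/-- The right side is the tangent line at `t = 1 / a`, scaled by `a`. With `u = a t` and `w = A / (A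
+ c)`, the claim reduces to `u ≤ (w u + (1 - w)) (w + (1 - w) u^b)^(1/b)`. This follows by writing
`u = u^w u^(1 - w)` and bounding each factor by the weighted AM-GM inequality. -/
theorem secrecyReach_le_tangent (hA : 0 < A) (hC : 0 ≤ C) (hb : 0 < b) {a t : ℝ} (ha : 0 < a)
    (ht : 0 < t) :
    a * secrecyReach A C b t ≤
      (A * (a * t) + C * (1 / a) ^ b) / (A + C * (1 / a) ^ b)
        * (1 / (A + C * (1 / a) ^ b) ^ (1 / b)) := by
  set c := C * (1 / a) ^ b with hc
  have hc0 : 0 ≤ c := by positivity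
  set u := a * t with hu
  have hu0 : 0 < u := by positivity
  have hD : 0 < A + c := by positivity
  set w := A / (A + c) with hw
  have hw0 : 0 ≤ w := by positivity
  have hw1 : 1 - w = c / (A + c) := by rw [hw]; field_simp; ring
  have hw1' : 0 ≤ 1 - w := by rw [hw1]; positivity
  have e1 : A + C * t ^ b = (A + c) * (w + (1 - w) * u ^ b) := by
    have : (1 / a) ^ b * u ^ b = t ^ b := by
      rw [← Real.mul_rpow (by positivity) hu0.le, hu]; congr 1; field_simp
    rw [hw1, hw, ← this, hc]; field_simp
  have e2 : (A * u + c) / (A + c) = w * u + (1 - w) := by rw [hw1, hw]; field_simp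
  have g1 := Real.geom_mean_le_arith_mean2_weighted hw0 hw1' hu0.le zero_le_one (by ring)
  have g2 := Real.geom_mean_le_arith_mean2_weighted hw0 hw1' zero_le_one
    (Real.rpow_nonneg hu0.le b) (by ring)
  simp only [Real.one_rpow, mul_one, one_mul] at g1 g2
  have hm : 0 < w + (1 - w) * u ^ b := lt_of_lt_of_le (by positivity) g2
  have g3 : u ^ (1 - w) ≤ (w + (1 - w) * u ^ b) ^ (1 / b) := by
    refine le_trans (le_of_eq ?_) (Real.rpow_le_rpow (by positivity) g2 (by positivity))
    rw [← Real.rpow_mul hu0.le, ← Real.rpow_mul hu0.le]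
    congr 1; field_simp
  have g4 : u ≤ (w * u + (1 - w)) * (w + (1 - w) * u ^ b) ^ (1 / b) := by
    calc u = u ^ w * u ^ (1 - w) := by rw [← Real.rpow_add hu0]; simp
      _ ≤ _ := mul_le_mul g1 g3 (by positivity) (by positivity)
  rw [e2, secrecyReach, e1, Real.mul_rpow hD.le hm.le, ← mul_div_assoc, ← hu,
    div_le_iff₀ (by positivity)]
  refine g4.trans (le_of_eq ?_)
  have : (A + c) ^ (1 / b) ≠ 0 := by positivity
  field_simp

theorem integral_id_mul_exp_neg {a : ℝ} (ha : 0 < a) :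
    ∫ x in Set.Ioi (0 : ℝ), x * Real.exp (-(a * x)) = 1 / a ^ 2 := by
  have h := Real.integral_rpow_mul_exp_neg_mul_Ioi (a := 2) two_pos ha
  norm_num [Real.Gamma_two] at h
  simpa using h

theorem integrableOn_id_mul_exp_neg {a : ℝ} (ha : 0 < a) :
    IntegrableOn (fun x : ℝ => x * Real.exp (-(a * x))) (Set.Ioi 0) := by
  have h := integrableOn_rpow_mul_exp_neg_mul_rpow (s := 1) (p := 1) (b := a) (by norm_num)
    one_pos ha
  simpa using h

/-- Dropping `C * t ^ b` bounds the reach by `t / A ^ (1 / b)`, which leaves a Gamma integral. -/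
theorem integrableOn_exp_mul_secrecyReach (hA : 0 < A) (hC : 0 ≤ C) (hb : 0 < b) {a : ℝ}
    (ha : 0 < a) :
    IntegrableOn (fun x : ℝ => Real.exp (-(a * x)) * secrecyReach A C b x) (Set.Ioi 0) := by
  refine ((integrableOn_id_mul_exp_neg ha).div_const (A ^ (1 / b))).mono'
    (Measurable.aestronglyMeasurable (by unfold secrecyReach; fun_prop)) ?_
  refine (ae_restrict_iff' measurableSet_Ioi).2 (Filter.Eventually.of_forall fun x hx => ?_)
  have hx : 0 < x := hx
  rw [Real.norm_of_nonneg (mul_nonneg (Real.exp_pos _).le (secrecyReach_nonneg hA hC hx.le)),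
    secrecyReach, mul_comm x, mul_div_assoc]
  gcongr
  have : 0 ≤ C * x ^ b := by positivity
  linarith

/-- Jensen's inequality for the exponential law: integrating the tangent line uses only its total
mass `1` and mean `1 / a`, so the line contributes its value at the point of tangency. -/
theorem integral_exp_mul_secrecyReach_le (hA : 0 < A) (hC : 0 ≤ C) (hb : 0 < b) {a : ℝ}
    (ha : 0 < a) :
    a ^ 2 * ∫ x in Set.Ioi (0 : ℝ), Real.exp (-(a * x)) * secrecyReach A C b x ≤
      1 / (A + C * (1 / a) ^ b) ^ (1 / b) := by
  set D := A + C * (1 / a) ^ b with hD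
  have hD0 : 0 < D := by positivity
  have hi1 : IntegrableOn (fun x : ℝ => Real.exp (-(a * x))) (Set.Ioi 0) := by
    simpa using exp_neg_integrableOn_Ioi 0 ha
  have h1 : ∫ x in Set.Ioi (0 : ℝ), Real.exp (-(a * x)) = 1 / a := by
    have := integral_exp_mul_Ioi (a := -a) (by linarith) 0
    simpa using this
  have hi2 := integrableOn_id_mul_exp_neg ha
  set K := 1 / D * (1 / D ^ (1 / b)) with hK
  have hle : ∫ x in Set.Ioi (0 : ℝ), a * (Real.exp (-(a * x)) * secrecyReach A C b x) ≤
      ∫ x in Set.Ioi (0 : ℝ), ((K * (A * a)) * (x * Real.exp (-(a * x)))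
        + K * (C * (1 / a) ^ b) * Real.exp (-(a * x))) := by
    refine setIntegral_mono_on ((integrableOn_exp_mul_secrecyReach hA hC hb ha).const_mul a)
      ((hi2.const_mul _).add (hi1.const_mul _)) measurableSet_Ioi fun x hx => ?_
    have := mul_le_mul_of_nonneg_left (secrecyReach_le_tangent hA hC hb ha hx)
      (Real.exp_pos (-(a * x))).le
    refine (le_of_eq (by ring)).trans (this.trans (le_of_eq ?_))
    rw [hK, ← hD]; ring
  rw [integral_const_mul, integral_add (hi2.const_mul _) (hi1.const_mul _), integral_const_mul,
    integral_const_mul, h1, integral_id_mul_exp_neg ha] at hle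
  have := mul_le_mul_of_nonneg_left hle ha.le
  refine (le_of_eq (by ring)).trans (this.trans (le_of_eq ?_))
  rw [hK]
  have : D ^ (1 / b) ≠ 0 := by positivity
  field_simp
  rw [hD]

/-! ### Edges and degrees in terms of the secrecy reach -/

/-- Network parameters with the power-law channel gain `r ^ (-2 b)`. -/
noncomputable def powerLawParams (Pl nL nE b : ℝ) : Params where
  power := Pl
  noiseL := nL
  noiseE := nE
  gain := fun r => 1 / r ^ (2 * b)

section Graph

variable {Pl nL nE b rho : ℝ}

/-- Positivity of `dist x y` matters: at distance zero, division by zero makes the gain `0` instead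
of infinite. -/
theorem receivedPower_anti (hPl : 0 < Pl) (hb : 0 < b) {x y z : Plane} (hy : 0 < dist x y)
    (hyz : dist x y ≤ dist x z) :
    (powerLawParams Pl nL nE b).receivedPower x z ≤
      (powerLawParams Pl nL nE b).receivedPower x y := by
  simp only [Params.receivedPower, powerLawParams]
  gcongr

/-- Local finiteness and nonemptiness provide a nearest eavesdropper, which is a strongest one. All
strongest eavesdroppers receive the same power, so the rate does not depend on the choice of argmax.
-/
theorem exists_isStrongest_iff (hPl : 0 < Pl) (hnL : 0 < nL) (hnE : 0 < nE) (hb : 0 < b)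
    (hrho : 0 ≤ rho) {E : Set Plane} (hE : IsLocallyFinite E) (hne : E.Nonempty) {x y : Plane}
    (hx : x ∉ E) (hxy : x ≠ y) :
    (∃ e, (powerLawParams Pl nL nE b).IsStrongest E x e ∧
        rho < (powerLawParams Pl nL nE b).secrecyRate x y e) ↔
      dist x y ^ 2 < secrecyReach (nL / nE * 2 ^ rho) (nL / Pl * (2 ^ rho - 1)) b
        (Metric.infDist x E ^ 2) := by
  obtain ⟨e, he, hd⟩ := hE.exists_infDist_eq hne x
  have hpos : ∀ z ∈ E, 0 < dist x z := fun z hz => dist_pos.2 fun h => hx (h ▸ hz)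
  have hmax : ∀ z ∈ E, (powerLawParams Pl nL nE b).receivedPower x z ≤
      (powerLawParams Pl nL nE b).receivedPower x e := fun z hz =>
    receivedPower_anti hPl hb (hpos e he) (hd ▸ Metric.infDist_le_dist_of_mem hz)
  have hiff : rho < (powerLawParams Pl nL nE b).secrecyRate x y e ↔
      dist x y ^ 2 < secrecyReach (nL / nE * 2 ^ rho) (nL / Pl * (2 ^ rho - 1)) b
        (Metric.infDist x E ^ 2) := by
    rw [hd]
    exact lt_logb_sub_logb_iff hPl hnL hnE hrho hb (dist_pos.2 hxy) (hpos e he)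
  rw [← hiff]
  constructor
  · rintro ⟨e', ⟨he', hs⟩, h⟩
    have : (powerLawParams Pl nL nE b).receivedPower x e' =
        (powerLawParams Pl nL nE b).receivedPower x e := le_antisymm (hmax e' he') (hs e he)
    rwa [Params.secrecyRate, this] at h
  · exact fun h => ⟨e, ⟨he, hmax⟩, h⟩

/-- The graph has no loops, whereas the origin could satisfy the distance condition; `0 ∉ L` keeps
it out of the count. -/
theorem typicalOutDegree_eq (hPl : 0 < Pl) (hnL : 0 < nL) (hnE : 0 < nE) (hb : 0 < b)
    (hrho : 0 ≤ rho) {L E : Set Plane} (hE : IsLocallyFinite E) (hne : E.Nonempty)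
    (h0L : 0 ∉ L) (h0E : 0 ∉ E) :
    typicalOutDegree (powerLawParams Pl nL nE b) rho L E =
      (L ∩ {x | dist x 0 ^ 2 < secrecyReach (nL / nE * 2 ^ rho) (nL / Pl * (2 ^ rho - 1)) b
        (Metric.infDist 0 E ^ 2)}).encard := by
  rw [typicalOutDegree, outDegree, ← Subtype.val_injective.encard_image]
  congr 1
  ext y
  simp only [Set.mem_image, Set.mem_ofPred_eq, iSGraph, Subtype.exists, exists_and_right,
    exists_eq_right, Set.mem_inter_iff, ne_eq, Subtype.mk.injEq]
  constructor
  · rintro ⟨⟨hy, hy0⟩, h⟩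
    refine ⟨hy.resolve_left (Ne.symm hy0), ?_⟩
    rwa [exists_isStrongest_iff hPl hnL hnE hb hrho hE hne h0E hy0, dist_comm] at h
  · rintro ⟨hy, h⟩
    have hy0 : (0 : Plane) ≠ y := fun h => h0L (h ▸ hy)
    refine ⟨⟨Or.inr hy, hy0⟩, ?_⟩
    rwa [exists_isStrongest_iff hPl hnL hnE hb hrho hE hne h0E hy0, dist_comm]

theorem typicalInDegree_eq (hPl : 0 < Pl) (hnL : 0 < nL) (hnE : 0 < nE) (hb : 0 < b)
    (hrho : 0 ≤ rho) {L E : Set Plane} (hE : IsLocallyFinite E) (hne : E.Nonempty)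
    (h0L : 0 ∉ L) (hLE : Disjoint L E) :
    typicalInDegree (powerLawParams Pl nL nE b) rho L E =
      (L ∩ {x | dist x 0 ^ 2 < secrecyReach (nL / nE * 2 ^ rho) (nL / Pl * (2 ^ rho - 1)) b
        (Metric.infDist x E ^ 2)}).encard := by
  rw [typicalInDegree, inDegree, ← Subtype.val_injective.encard_image]
  congr 1
  ext y
  simp only [Set.mem_image, Set.mem_ofPred_eq, iSGraph, Subtype.exists, exists_and_right,
    exists_eq_right, Set.mem_inter_iff, ne_eq, Subtype.mk.injEq]
  constructor
  · rintro ⟨⟨hy, hy0⟩, h⟩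
    have hyL := hy.resolve_left hy0
    refine ⟨hyL, ?_⟩
    rwa [exists_isStrongest_iff hPl hnL hnE hb hrho hE hne (Set.disjoint_left.1 hLE hyL) hy0] at h
  · rintro ⟨hy, h⟩
    have hy0 : y ≠ 0 := fun h => h0L (h ▸ hy)
    refine ⟨⟨Or.inr hy, hy0⟩, ?_⟩
    rwa [exists_isStrongest_iff hPl hnL hnE hb hrho hE hne (Set.disjoint_left.1 hLE hy) hy0]

end Graph

/-! ### Mean degrees -/

section Mean

variable {Ω : Type*} [MeasurableSpace Ω] {P : Measure Ω} [IsProbabilityMeasure P]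
  {lamL lamE A C b : ℝ} {L E : Ω → Set Plane}

/-- The mean area of the disk of squared radius `secrecyReach`. -/
theorem lintegral_expMeasure_lt_secrecyReach (hA : 0 < A) (hC : 0 ≤ C) (hb : 0 < b) {a : ℝ}
    (ha : 0 < a) :
    ∫⁻ x : Plane, expMeasure a {t | dist x 0 ^ 2 < secrecyReach A C b t} =
      ENNReal.ofReal (Real.pi * a *
        ∫ t in Set.Ioi (0 : ℝ), Real.exp (-(a * t)) * secrecyReach A C b t) := by
  have := isProbabilityMeasure_expMeasure ha
  have hS : MeasurableSet {z : Plane × ℝ | dist z.1 0 ^ 2 < secrecyReach A C b z.2} :=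
    measurableSet_lt (by fun_prop) (measurable_secrecyReach.comp measurable_snd)
  have harea : ∀ t, 0 ≤ t → volume {x : Plane | dist x 0 ^ 2 < secrecyReach A C b t} =
      ENNReal.ofReal (Real.pi * secrecyReach A C b t) := fun t ht => by
    have hr := secrecyReach_nonneg (b := b) hA hC ht
    have : {x : Plane | dist x 0 ^ 2 < secrecyReach A C b t} =
        Metric.ball 0 √(secrecyReach A C b t) := by
      ext x
      simp only [Set.mem_ofPred_eq, Metric.mem_ball, Real.lt_sqrt dist_nonneg]
    rw [this, EuclideanSpace.volume_ball_fin_two, ← ENNReal.ofReal_pow (Real.sqrt_nonneg _),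
      Real.sq_sqrt hr, ← ENNReal.ofReal_mul hr, mul_comm]
  -- Tonelli: both sides measure the same region of pairs `(x, t)`, and for fixed `t` its section is
  -- a disk.
  have h1 : ∫⁻ x : Plane, expMeasure a {t | dist x 0 ^ 2 < secrecyReach A C b t} =
      ∫⁻ t, volume {x : Plane | dist x 0 ^ 2 < secrecyReach A C b t} ∂expMeasure a :=
    (Measure.prod_apply hS).symm.trans (Measure.prod_apply_symm hS)
  have hpdf : Measurable (exponentialPDF a) := (measurable_exponentialPDFReal a).ennreal_ofReal
  have hm : Measurable fun t => volume {x : Plane | dist x 0 ^ 2 < secrecyReach A C b t} :=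
    measurable_measure_prodMk_right hS
  rw [h1, show expMeasure a = volume.withDensity (exponentialPDF a) from rfl,
    lintegral_withDensity_eq_lintegral_mul _ hpdf hm]
  have h2 : ∀ t, (exponentialPDF a *
      fun t => volume {x : Plane | dist x 0 ^ 2 < secrecyReach A C b t}) t =
      (Set.Ici 0).indicator (fun t => ENNReal.ofReal
        (Real.pi * a * (Real.exp (-(a * t)) * secrecyReach A C b t))) t := fun t => by
    rw [Pi.mul_apply]
    by_cases ht : 0 ≤ t
    · rw [Set.indicator_of_mem (Set.mem_Ici.2 ht), exponentialPDF_of_nonneg ht, harea t ht,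
        ← ENNReal.ofReal_mul (by positivity)]
      congr 1
      ring
    · rw [Set.indicator_of_notMem (by simpa using ht), exponentialPDF_of_neg (not_le.1 ht),
        zero_mul]
  have hi := (integrableOn_exp_mul_secrecyReach hA hC hb ha).const_mul (Real.pi * a)
  rw [lintegral_congr h2, lintegral_indicator measurableSet_Ici,
    setLIntegral_congr Ioi_ae_eq_Ici.symm, ← integral_const_mul,
    ofReal_integral_eq_lintegral_ofReal hi]
  refine (ae_restrict_iff' measurableSet_Ioi).2 (Filter.Eventually.of_forall fun t ht => ?_)
  exact mul_nonneg (by positivity)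
    (mul_nonneg (Real.exp_pos _).le (secrecyReach_nonneg hA hC (le_of_lt ht)))

/-- Campbell's formula for the number of points `x` of `L` with `dist x 0 ^ 2` less than a function
of the squared distance from `E` to the point `c x`. -/
theorem lintegral_encard_lt_infDist_sq (hL : IsPoissonProcess P lamL L) (hlamL : 0 < lamL)
    (hE : IsPoissonProcess P lamE E) (hlamE : 0 < lamE) (hLE : IndepProcesses P L E)
    {c : Plane → Plane} (hc : Measurable c) {ρ : ℝ → ℝ} (hρ : Measurable ρ) :
    AEMeasurable (fun ω => ((L ω ∩
        {x | dist x 0 ^ 2 < ρ (Metric.infDist (c x) (E ω) ^ 2)}).encard : ℝ≥0∞)) P ∧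
      ∫⁻ ω, ((L ω ∩ {x | dist x 0 ^ 2 < ρ (Metric.infDist (c x) (E ω) ^ 2)}).encard : ℝ≥0∞) ∂P =
        ENNReal.ofReal lamL *
          ∫⁻ x : Plane, expMeasure (Real.pi * lamE) {t | dist x 0 ^ 2 < ρ t} := by
  set S : Set (Plane × Configuration) :=
    {z | dist z.1 0 ^ 2 < ρ (Metric.infDist (c z.1) z.2.points ^ 2)} with hSdef
  have hcm : Measurable fun z : Plane × Configuration => (c z.1, z.2) := by fun_prop
  have hS : MeasurableSet S := measurableSet_lt (by fun_prop)
    (hρ.comp ((measurable_infDist_configuration.comp hcm).pow_const 2))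
  have hh := measurable_one.indicator (f := (1 : Plane × Configuration → ℝ≥0∞)) hS
  have hcount : (fun ω => ((L ω ∩
      {x | dist x 0 ^ 2 < ρ (Metric.infDist (c x) (E ω) ^ 2)}).encard : ℝ≥0∞)) =
      fun ω => ∫⁻ x, S.indicator 1 (x, Configuration.mk (E ω)) ∂pointMeasure (L ω) := by
    ext ω
    have hSω : MeasurableSet {x | dist x 0 ^ 2 < ρ (Metric.infDist (c x) (E ω) ^ 2)} :=
      measurable_prodMk_right (y := Configuration.mk (E ω)) hS
    rw [← pointMeasure_apply _ hSω, ← lintegral_indicator_one hSω]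
    rfl
  rw [hcount]
  refine ⟨hL.aemeasurable_lintegral_pointMeasure hE.measurable hh, ?_⟩
  rw [hL.lintegral_lintegral_pointMeasure hlamL.le hE.measurable hLE.indepFun hh]
  congr 1
  refine lintegral_congr fun x => ?_
  have ht : MeasurableSet {t | dist x 0 ^ 2 < ρ t} := measurableSet_lt measurable_const hρ
  have hm := (hE.measurable_infDist (c x)).pow_const 2
  -- The law of the squared distance is the same at every point, so `c` disappears from the mean.
  rw [← hE.map_infDist_sq hlamE (c x), Measure.map_apply hm ht,
    ← lintegral_indicator_one (hm ht)]
  rfl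

end Mean

end SecrecyGraph

theorem mainTheorem6 {Ω : Type*} [MeasurableSpace Ω] (P : Measure Ω) [IsProbabilityMeasure P]
    (lamL lamE Pl sigL sigE b rho : ℝ)
    (hlamL : 0 < lamL) (hlamE : 0 < lamE) (hPl : 0 < Pl) (hsigL : 0 < sigL) (hsigE : 0 < sigE)
    (hb : 0 < b) (hrho : 0 ≤ rho)
    (L E : Ω → Set SecrecyGraph.Plane)
    (hL : SecrecyGraph.IsPoissonProcess P lamL L)
    (hE : SecrecyGraph.IsPoissonProcess P lamE E)
    (hLE : SecrecyGraph.IndepProcesses P L E)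
    (p : SecrecyGraph.Params)
    (hp : p = { power := Pl, noiseL := sigL ^ 2, noiseE := sigE ^ 2,
                gain := fun r => 1 / r ^ (2 * b) })
    (Nout Nin : Ω → ℝ≥0∞)
    (hNout : Nout = fun ω => ((SecrecyGraph.typicalOutDegree p rho (L ω) (E ω) : ℕ∞) : ℝ≥0∞))
    (hNin : Nin = fun ω => ((SecrecyGraph.typicalInDegree p rho (L ω) (E ω) : ℕ∞) : ℝ≥0∞))
    (f : ℝ → ℝ)
    (hf : f = fun x => x * Real.exp (-(Real.pi * lamE * x)) /
      (sigL ^ 2 / sigE ^ 2 * (2 : ℝ) ^ rho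
        + sigL ^ 2 / Pl * ((2 : ℝ) ^ rho - 1) * x ^ b) ^ (1 / b)) :
    AEMeasurable Nout P ∧ AEMeasurable Nin P ∧ IntegrableOn f (Set.Ioi 0) ∧
    ∫⁻ ω, Nin ω ∂P = ∫⁻ ω, Nout ω ∂P ∧
    ∫⁻ ω, Nout ω ∂P = ENNReal.ofReal (Real.pi ^ 2 * lamL * lamE * ∫ x in Set.Ioi (0 : ℝ), f x) ∧
    Real.pi ^ 2 * lamL * lamE * (∫ x in Set.Ioi (0 : ℝ), f x) ≤
      lamL / lamE * (1 / (sigL ^ 2 / sigE ^ 2 * (2 : ℝ) ^ rho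
        + sigL ^ 2 / (Pl * (Real.pi * lamE) ^ b) * ((2 : ℝ) ^ rho - 1)) ^ (1 / b)) := by
  have hnL : 0 < sigL ^ 2 := by positivity
  have hnE : 0 < sigE ^ 2 := by positivity
  have ha : 0 < Real.pi * lamE := mul_pos Real.pi_pos hlamE
  set A := sigL ^ 2 / sigE ^ 2 * (2 : ℝ) ^ rho with hAdef
  set C := sigL ^ 2 / Pl * ((2 : ℝ) ^ rho - 1) with hCdef
  have hA : 0 < A := by positivity
  have hC : 0 ≤ C := mul_nonneg (by positivity)
    (sub_nonneg.2 (Real.one_le_rpow one_le_two hrho))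
  have hfeq : f = fun x => Real.exp (-(Real.pi * lamE * x)) * SecrecyGraph.secrecyReach A C b x := by
    rw [hf]
    ext x
    rw [SecrecyGraph.secrecyReach]
    ring
  have hp' : p = SecrecyGraph.powerLawParams Pl (sigL ^ 2) (sigE ^ 2) b := hp
  have houtae : Nout =ᵐ[P] fun ω => ((L ω ∩ {x | dist x 0 ^ 2 <
      SecrecyGraph.secrecyReach A C b (Metric.infDist 0 (E ω) ^ 2)}).encard : ℝ≥0∞) := by
    filter_upwards [hE.ae_isLocallyFinite, hE.ae_nonempty hlamE, hL.ae_notMem hlamL 0,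
      hE.ae_notMem hlamE 0] with ω h1 h2 h3 h4
    rw [hNout, hp', ← SecrecyGraph.typicalOutDegree_eq hPl hnL hnE hb hrho h1 h2 h3 h4]
  have hinae : Nin =ᵐ[P] fun ω => ((L ω ∩ {x | dist x 0 ^ 2 <
      SecrecyGraph.secrecyReach A C b (Metric.infDist x (E ω) ^ 2)}).encard : ℝ≥0∞) := by
    filter_upwards [hE.ae_isLocallyFinite, hE.ae_nonempty hlamE, hL.ae_notMem hlamL 0,
      hL.ae_disjoint hlamL hE hlamE hLE] with ω h1 h2 h3 h4
    rw [hNin, hp', ← SecrecyGraph.typicalInDegree_eq hPl hnL hnE hb hrho h1 h2 h3 h4]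
  -- For the out-degree the transmitter is always the origin; for the in-degree it is the counted
  -- point itself.
  obtain ⟨houtm, hout⟩ := SecrecyGraph.lintegral_encard_lt_infDist_sq hL hlamL hE hlamE hLE
    (c := fun _ => 0) measurable_const
    (SecrecyGraph.measurable_secrecyReach (A := A) (C := C) (b := b))
  obtain ⟨hinm, hin⟩ := SecrecyGraph.lintegral_encard_lt_infDist_sq hL hlamL hE hlamE hLE
    (c := fun x => x) measurable_id
    (SecrecyGraph.measurable_secrecyReach (A := A) (C := C) (b := b))
  rw [← lintegral_congr_ae houtae] at hout
  rw [← lintegral_congr_ae hinae] at hin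
  refine ⟨houtm.congr houtae.symm, hinm.congr hinae.symm, ?_, hin.trans hout.symm, ?_, ?_⟩
  · rw [hfeq]
    exact SecrecyGraph.integrableOn_exp_mul_secrecyReach hA hC hb ha
  · rw [hout, SecrecyGraph.lintegral_expMeasure_lt_secrecyReach hA hC hb ha,
      ← ENNReal.ofReal_mul hlamL.le, hfeq]
    congr 1
    ring
  · have h := SecrecyGraph.integral_exp_mul_secrecyReach_le hA hC hb ha
    have hD : sigL ^ 2 / (Pl * (Real.pi * lamE) ^ b) * ((2 : ℝ) ^ rho - 1) =
        C * (1 / (Real.pi * lamE)) ^ b := by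
      rw [Real.div_rpow zero_le_one ha.le, Real.one_rpow, hCdef]
      field_simp
    rw [hD, hfeq]
    -- The Jensen bound is scaled by `lamL / lamE`, as `π² lamL lamE = (lamL / lamE) (π lamE)²`.
    refine le_trans (le_of_eq ?_) (mul_le_mul_of_nonneg_left h (by positivity))
    field_simp
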